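/- Let $R$ be a commutative local ring (a ring with a unique maximal ideal, not assumed Noetherian) of Krull dimension $1$ with maximal ideal $M$, suppose that $M$ is regular (i.e. contains a nonzerodivisor), and let $m \in M$ be a nonzerodivisor. Let $\widetilde{R} = \varprojlim_n R/m^nR$ be the $mR$-adic completion of $R$. An ideal is called regular if it contains a nonzerodivisor, and two-generated if it can be generated by two elements. For a Noetherian local ring $(A,N)$ of Krull dimension $d$, the length of $A/N^n$ is, for all sufficiently large $n$, given by a polynomial in $n$ of degree $d$; the multiplicity of $A$ is $d!$ times the leading coefficient of this polynomial. Then the following statements are equivalent. 1. $M^n$ is two-generated for some $n \geq 2$. 2. $\widetilde{R}$ is a Noetherian local ring of multiplicity at most $2$. 3. Every regular ideal of $R$ is two-generated. -/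

import Mathlib

open scoped Nat

/-- An ideal is regular if it contains a nonzerodivisor. -/
def RegularIdeal {R : Type*} [CommRing R] (I : Ideal R) : Prop :=
  ∃ x ∈ I, x ∈ nonZeroDivisors R

/-- An ideal is two-generated if it can be generated by two (not necessarily distinct) elements. -/
def TwoGenerated {R : Type*} [CommRing R] (I : Ideal R) : Prop :=
  ∃ x y : R, I = Ideal.span {x, y}

/-- The local ring `A` with maximal ideal `M` has multiplicity `e`: there is a polynomial `p` of
degree `d = dim A` such that `A / M ^ n` has finite length `p(n)` for all large `n`, and `e` is
`d!` times the leading coefficient of `p`. For a Noetherian local ring such `p` and `e` exist and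
are unique. -/
def HasMultiplicity (A : Type*) [CommRing A] [IsLocalRing A] (e : ℚ) : Prop :=
  ∃ (d : ℕ) (p : Polynomial ℚ),
    ringKrullDim A = d ∧ p.natDegree = d ∧
    (∀ᶠ n : ℕ in Filter.atTop, ∃ l : ℕ,
      Module.length A (A ⧸ IsLocalRing.maximalIdeal A ^ n) = l ∧ (l : ℚ) = p.eval (n : ℚ)) ∧
    e = (d ! : ℚ) * p.leadingCoeff

open IsLocalRing Pointwise

/-- The length of `J / (I ∩ J)` for submodules `I` and `J`. -/
noncomputable def relLength {R E : Type*} [CommRing R] [AddCommGroup E] [Module R E]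
    (I J : Submodule R E) : ℕ∞ :=
  Module.length R (J ⧸ I.submoduleOf J)

section RelLength

variable {R E : Type*} [CommRing R] [AddCommGroup E] [Module R E]

theorem relLength_eq_add {I J K : Submodule R E} (hIJ : I ≤ J) (hJK : J ≤ K) :
    relLength I K = relLength I J + relLength J K := by
  let f : (J ⧸ I.submoduleOf J) →ₗ[R] (K ⧸ I.submoduleOf K) :=
    Submodule.mapQ _ _ (Submodule.inclusion hJK) (fun x hx => hx)
  let g : (K ⧸ I.submoduleOf K) →ₗ[R] (K ⧸ J.submoduleOf K) :=
    Submodule.mapQ _ _ LinearMap.id (fun x hx => hIJ hx)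
  refine Module.length_eq_add_of_exact f g ?_ ?_ ?_
  · rw [← LinearMap.ker_eq_bot, LinearMap.ker_eq_bot']
    intro x
    induction x using Submodule.Quotient.induction_on with | _ x
    intro hx
    rw [Submodule.Quotient.mk_eq_zero]
    exact (Submodule.Quotient.mk_eq_zero (I.submoduleOf K)).1 hx
  · intro x
    induction x using Submodule.Quotient.induction_on with | _ x
    exact ⟨Submodule.Quotient.mk x, rfl⟩
  · intro x
    induction x using Submodule.Quotient.induction_on with | _ x
    constructor
    · intro hx
      have hx : (x : E) ∈ J := (Submodule.Quotient.mk_eq_zero (J.submoduleOf K)).1 hx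
      exact ⟨Submodule.Quotient.mk ⟨x, hx⟩, rfl⟩
    · rintro ⟨z, hz⟩
      induction z using Submodule.Quotient.induction_on with | _ z
      rw [← hz]
      exact (Submodule.Quotient.mk_eq_zero _).2 z.2

theorem relLength_top (I : Submodule R E) : relLength I ⊤ = Module.length R (E ⧸ I) :=
  (Submodule.Quotient.equiv (I.submoduleOf ⊤) I Submodule.topEquiv
    (by ext x; simp [Submodule.submoduleOf])).length_eq

theorem relLength_eq_zero {I J : Submodule R E} : relLength I J = 0 ↔ J ≤ I := by
  rw [relLength, Module.length_eq_zero_iff, Submodule.Quotient.subsingleton_iff,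
    Submodule.submoduleOf_eq_top]

theorem relLength_smul {I J : Submodule R E} {y : R} (hy : IsSMulRegular E y) :
    relLength (y • I) (y • J) = relLength I J := by
  let e : J ≃ₗ[R] (y • J : Submodule R E) :=
    Submodule.equivMapOfInjective (DistribSMul.toLinearMap R E y) hy J
  refine (Submodule.Quotient.equiv _ _ e ?_).length_eq.symm
  ext x
  constructor
  · rintro ⟨z, hz, rfl⟩
    exact Submodule.smul_mem_pointwise_smul _ y I hz
  · rintro hx
    obtain ⟨z, hz, hzx⟩ := (Submodule.mem_smul_pointwise_iff_exists _ _ _).1 hx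
    obtain ⟨w, rfl⟩ := e.surjective x
    have hw : y • (w : E) = y • z := hzx.symm
    have := hy hw
    exact ⟨w, by simpa [Submodule.submoduleOf, this] using hz, rfl⟩

theorem exists_relLength_span_singleton_sup_le {I N : Submodule R E} (hIN : I ≤ N) {k : ℕ}
    (h : relLength I N ≤ k + 1) :
    ∃ a ∈ N, relLength (R ∙ a ⊔ I) N ≤ k := by
  by_cases hN : N ≤ I
  · exact ⟨0, zero_mem _, by rw [relLength_eq_zero.2 (hN.trans le_sup_right)]; exact zero_le⟩
  obtain ⟨a, ha, haI⟩ := SetLike.not_le_iff_exists.1 hN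
  refine ⟨a, ha, ?_⟩
  have hle : R ∙ a ⊔ I ≤ N := sup_le ((Submodule.span_singleton_le_iff_mem _ _).2 ha) hIN
  rw [relLength_eq_add le_sup_right hle] at h
  have h1 : 1 ≤ relLength I (R ∙ a ⊔ I) := by
    rw [Order.one_le_iff_ne_zero, Ne, relLength_eq_zero]
    exact fun hc => haI (hc (Submodule.mem_sup_left (Submodule.mem_span_singleton_self a)))
  have h2 : relLength (R ∙ a ⊔ I) N + 1 ≤ k + 1 := by
    rw [add_comm]
    exact (add_le_add_left h1 _).trans h
  exact (ENat.add_le_add_iff_right (by simp)).1 h2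

end RelLength

theorem ringKrullDim_quotient_span_singleton_eq_zero {R : Type*} [CommRing R] [IsLocalRing R]
    (hdim : ringKrullDim R = 1) {x : R} (hxM : x ∈ maximalIdeal R) (hx : x ∈ nonZeroDivisors R) :
    ringKrullDim (R ⧸ Ideal.span {x}) = 0 := by
  have h := ringKrullDim_quotient_succ_le_of_nonZeroDivisor hx
  have : Nontrivial (R ⧸ Ideal.span {x}) := Ideal.Quotient.nontrivial_iff.2 fun hc =>
    (mem_maximalIdeal x).1 hxM (Ideal.span_singleton_eq_top.1 hc)
  rw [hdim] at h
  refine le_antisymm ?_ ringKrullDim_nonneg_of_nontrivial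
  exact (ENat.WithBot.add_le_add_one_right_iff).1 (by simpa using h)

section LocalRing

variable {R E : Type*} [CommRing R] [IsLocalRing R] [AddCommGroup E] [Module R E]

theorem relLength_span_singleton_sup_le {I : Submodule R E} {a : E}
    (h : ∀ r ∈ maximalIdeal R, r • a ∈ I) : relLength I (R ∙ a ⊔ I) ≤ 1 := by
  have ha : a ∈ R ∙ a ⊔ I := Submodule.mem_sup_left (Submodule.mem_span_singleton_self a)
  let f : R →ₗ[R] ((R ∙ a ⊔ I : Submodule R E) ⧸ I.submoduleOf (R ∙ a ⊔ I)) :=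
    (Submodule.mkQ _).comp (LinearMap.toSpanSingleton R _ ⟨a, ha⟩)
  have hf : Submodule.restrictScalars R (maximalIdeal R) ≤ LinearMap.ker f := fun r hr => by
    rw [LinearMap.mem_ker]
    exact (Submodule.Quotient.mk_eq_zero _).2 (h r hr)
  have : IsSimpleModule R (R ⧸ maximalIdeal R) := isSimpleModule_iff_isCoatom.2
    (Ideal.isMaximal_def.1 inferInstance)
  rw [← Module.length_eq_one R (R ⧸ maximalIdeal R)]
  refine Module.length_le_of_surjective (Submodule.liftQ _ f hf) ?_
  intro x
  induction x using Submodule.Quotient.induction_on with | _ x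
  obtain ⟨x, hx⟩ := x
  obtain ⟨z, hz, w, hw, rfl⟩ := Submodule.mem_sup.1 hx
  obtain ⟨r, rfl⟩ := Submodule.mem_span_singleton.1 hz
  refine ⟨Submodule.Quotient.mk r, ?_⟩
  refine (Submodule.Quotient.eq _).2 ?_
  change r • a - (r • a + w) ∈ I
  simpa using hw

theorem relLength_span_pair_le {I : Submodule R E} {a b : E}
    (ha : ∀ r ∈ maximalIdeal R, r • a ∈ I) (hb : ∀ r ∈ maximalIdeal R, r • b ∈ I)
    (hI : I ≤ Submodule.span R {a, b}) : relLength I (Submodule.span R {a, b}) ≤ 2 := by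
  have h : Submodule.span R {a, b} = R ∙ a ⊔ (R ∙ b ⊔ I) := by
    rw [Submodule.span_insert, ← sup_assoc, eq_comm, sup_eq_left, ← Submodule.span_insert]
    exact hI
  rw [h, relLength_eq_add (J := R ∙ b ⊔ I) le_sup_right le_sup_right]
  calc _ ≤ (1 : ℕ∞) + 1 := by
        gcongr
        · exact relLength_span_singleton_sup_le hb
        · exact relLength_span_singleton_sup_le fun r hr => Submodule.mem_sup_right (ha r hr)
    _ = 2 := one_add_one_eq_two

theorem exists_eq_span_pair {N : Submodule R E} (hN : N.FG)
    (h : relLength (maximalIdeal R • N) N ≤ 2) : ∃ a b : E, N = Submodule.span R {a, b} := by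
  have hle : maximalIdeal R • N ≤ N := Submodule.smul_le_right
  obtain ⟨a, ha, h1⟩ := exists_relLength_span_singleton_sup_le (k := 1) hle
    (by simpa [one_add_one_eq_two] using h)
  have hle1 : R ∙ a ⊔ maximalIdeal R • N ≤ N :=
    sup_le ((Submodule.span_singleton_le_iff_mem _ _).2 ha) hle
  obtain ⟨b, hb, h2⟩ := exists_relLength_span_singleton_sup_le (k := 0) hle1 (by simpa using h1)
  rw [Nat.cast_zero, nonpos_iff_eq_zero, relLength_eq_zero] at h2
  refine ⟨a, b, le_antisymm ?_ ?_⟩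
  · refine Submodule.le_of_le_smul_of_le_jacobson_bot hN (maximalIdeal_le_jacobson _) ?_
    rw [Submodule.span_insert, sup_comm (R ∙ a), sup_assoc]
    exact h2
  · rw [Submodule.span_le]
    rintro x (rfl | rfl) <;> assumption

end LocalRing

section AdicallyComplete

theorem mem_span_singleton_pow_smul_top_iff {A E : Type*} [CommRing A] [AddCommGroup E]
    [Module A E] {t : A} {n : ℕ} {x : E} :
    x ∈ (Ideal.span {t} ^ n • ⊤ : Submodule A E) ↔ ∃ z : E, t ^ n • z = x := by
  rw [Ideal.span_singleton_pow, Submodule.ideal_span_singleton_smul,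
    Submodule.mem_smul_pointwise_iff_exists]
  simp

theorem IsPrecomplete.pi_of_span_singleton {A ι : Type*} [CommRing A] {t : A}
    [IsPrecomplete (Ideal.span {t}) A] : IsPrecomplete (Ideal.span {t}) (ι → A) := by
  refine ⟨fun f hf => ?_⟩
  have key (i : ι) : ∃ l : A, ∀ n, f n i ≡ l [SMOD (Ideal.span {t} ^ n • ⊤ : Submodule A A)] := by
    refine IsPrecomplete.prec inferInstance fun {p q} hpq => ?_
    have := hf hpq
    rw [SModEq.sub_mem, mem_span_singleton_pow_smul_top_iff] at this ⊢
    obtain ⟨z, hz⟩ := this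
    exact ⟨z i, congrFun hz i⟩
  choose l hl using key
  refine ⟨l, fun n => ?_⟩
  have (i : ι) := SModEq.sub_mem.1 (hl i n)
  simp only [mem_span_singleton_pow_smul_top_iff] at this
  choose z hz using this
  rw [SModEq.sub_mem, mem_span_singleton_pow_smul_top_iff]
  exact ⟨z, funext hz⟩

theorem Ideal.le_span_of_le_sup_smul {A : Type*} [CommRing A] {t : A}
    [IsAdicComplete (Ideal.span {t}) A] {P : Ideal A} {s : Finset A} (hs : (s : Set A) ⊆ P)
    (h : P ≤ Ideal.span s ⊔ Ideal.span {t} * P) : P ≤ Ideal.span s := by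
  have : IsPrecomplete (Ideal.span {t}) (s → A) := IsPrecomplete.pi_of_span_singleton
  have : IsHausdorff (Ideal.span {t}) P := ⟨fun x hx => by
    apply Subtype.ext
    refine IsHausdorff.haus (I := Ideal.span {t}) inferInstance (x : A) fun n => ?_
    have := hx n
    rw [SModEq.zero, mem_span_singleton_pow_smul_top_iff] at this ⊢
    obtain ⟨z, rfl⟩ := this
    exact ⟨z, rfl⟩⟩
  let f : (s → A) →ₗ[A] P := Fintype.linearCombination A fun i : s => (⟨i, hs i.2⟩ : P)
  have hf : ∀ c, (f c : A) = Fintype.linearCombination A (fun i : s => (i : A)) c := by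
    intro c
    simp [f, Fintype.linearCombination_apply]
  have hsurj : Function.Surjective f := by
    refine surjective_of_mkQ_comp_surjective (I := Ideal.span {t}) fun x => ?_
    induction x using Submodule.Quotient.induction_on with | _ x
    obtain ⟨u, hu, v, hv, huv⟩ := Submodule.mem_sup.1 (h x.2)
    obtain ⟨w, hw, rfl⟩ := Ideal.mem_span_singleton_mul.1 hv
    have hr : Submodule.span A (s : Set A) = LinearMap.range
        (Fintype.linearCombination A (fun i : s => (i : A))) := by
      rw [Fintype.range_linearCombination]; congr 1; exact Subtype.range_coe.symm
    rw [Ideal.span, hr] at hu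
    obtain ⟨c, rfl⟩ := hu
    refine ⟨c, ?_⟩
    refine (Submodule.Quotient.eq _).2 ?_
    rw [← pow_one (Ideal.span {t}), mem_span_singleton_pow_smul_top_iff]
    refine ⟨-⟨w, hw⟩, Subtype.ext ?_⟩
    simp [hf, ← huv]
  intro x hx
  obtain ⟨c, hc⟩ := hsurj ⟨x, hx⟩
  have := congrArg Subtype.val hc
  rw [hf] at this
  rw [← show _ = x from this, Fintype.linearCombination_apply]
  exact Submodule.sum_mem _ fun i _ => Submodule.smul_mem _ _ (Ideal.subset_span i.2)

/-- A ring that is complete for a principal ideal is Noetherian if the quotient is. -/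
theorem isNoetherianRing_of_isAdicComplete_span_singleton {A : Type*} [CommRing A] (t : A)
    [IsAdicComplete (Ideal.span {t}) A] [IsNoetherianRing (A ⧸ Ideal.span {t})] :
    IsNoetherianRing A := by
  classical
  refine IsNoetherianRing.of_prime fun P hP => ?_
  have hfg : (P.map (Ideal.Quotient.mk (Ideal.span {t}))).FG := (isNoetherianRing_iff_ideal_fg _).1
    inferInstance _
  by_cases ht : t ∈ P
  · refine Ideal.fg_of_fg_map_of_fg_inf_ker_of_surjective
      (f := Ideal.Quotient.mk (Ideal.span {t})) hfg ?_ Ideal.Quotient.mk_surjective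
    rw [Ideal.mk_ker, inf_eq_right.2 ((Ideal.span_singleton_le_iff_mem _).2 ht)]
    exact ⟨{t}, by simp⟩
  · obtain ⟨s', hs', hs⟩ := (Submodule.fg_span_iff_fg_span_finset_subset _).1 hfg
    obtain ⟨s, hsP, rfl⟩ := Finset.subset_set_image_iff.1 hs'
    refine ⟨s, le_antisymm (Submodule.span_le.2 hsP)
      (Ideal.le_span_of_le_sup_smul (t := t) hsP fun x hx => ?_)⟩
    have hx' : Ideal.Quotient.mk (Ideal.span {t}) x ∈
        (Ideal.span (s : Set A)).map (Ideal.Quotient.mk (Ideal.span {t})) := by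
      rw [Ideal.map_span, ← Finset.coe_image]
      change _ ∈ Submodule.span _ _
      rw [← hs]
      exact Ideal.mem_map_of_mem _ hx
    rw [Ideal.mem_map_iff_of_surjective _ Ideal.Quotient.mk_surjective] at hx'
    obtain ⟨u, hu, hux⟩ := hx'
    rw [eq_comm, Ideal.Quotient.eq, Ideal.mem_span_singleton] at hux
    obtain ⟨a, ha⟩ := hux
    have haP : a ∈ P := (hP.mem_or_mem (ha ▸ sub_mem hx (Submodule.span_le.2 hsP hu))).resolve_left
      ht
    rw [← add_sub_cancel u x, ha]
    exact Submodule.add_mem_sup hu (Ideal.mul_mem_mul (Ideal.mem_span_singleton_self t) haP)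

end AdicallyComplete

namespace AdicCompletion

variable {R : Type*} [CommRing R] {I : Ideal R}

theorem mem_map_pow_iff_evalₐ (hI : I.FG) {n : ℕ} {x : AdicCompletion I R} :
    x ∈ (I ^ n).map (algebraMap R (AdicCompletion I R)) ↔ evalₐ I n x = 0 := by
  have h := congrArg (x ∈ ·) (pow_smul_top_eq_ker_eval (M := R) (n := n) hI)
  have h1 : x ∈ (I ^ n • ⊤ : Submodule R (AdicCompletion I R)) ↔
      x ∈ (I ^ n).map (algebraMap R (AdicCompletion I R)) := by
    rw [Ideal.smul_top_eq_map]; rfl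
  rw [← h1]
  refine (iff_of_eq h).trans ?_
  rw [LinearMap.mem_ker]
  constructor
  · intro hx
    rw [← factor_eval_eq_evalₐ I x (by simp), hx, _root_.map_zero]
  · intro hx
    rw [← factor_evalₐ_eq_eval I x (by simp), hx, _root_.map_zero]

theorem exists_sub_algebraMap_mem (hI : I.FG) (n : ℕ) (x : AdicCompletion I R) :
    ∃ r : R, x - algebraMap R _ r ∈ (I ^ n).map (algebraMap R (AdicCompletion I R)) := by
  obtain ⟨r, hr⟩ := Ideal.Quotient.mk_surjective (evalₐ I n x)
  refine ⟨r, ?_⟩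
  rw [mem_map_pow_iff_evalₐ hI, map_sub, ← hr, AlgHom.commutes, sub_eq_zero]
  rfl

theorem algebraMap_mem_map_iff {K : Ideal R} {n : ℕ} (hK : I ^ n ≤ K) {r : R} :
    algebraMap R (AdicCompletion I R) r ∈ K.map (algebraMap R (AdicCompletion I R)) ↔ r ∈ K := by
  refine ⟨fun h => ?_, fun h => Ideal.mem_map_of_mem _ h⟩
  have h2 := Ideal.mem_map_of_mem (evalₐ I n).toRingHom h
  rw [Ideal.map_map] at h2
  have hc : (evalₐ I n).toRingHom.comp (algebraMap R (AdicCompletion I R)) =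
      Ideal.Quotient.mk (I ^ n) := (evalₐ I n).comp_algebraMap
  have h3 : Ideal.Quotient.mk (I ^ n) r ∈ K.map (Ideal.Quotient.mk (I ^ n)) := by
    rw [← hc]; exact h2
  rw [Ideal.mem_quotient_iff_mem hK] at h3
  exact h3

variable (I) in
/-- The isomorphism `R / K ≃ A / K A` for an open ideal `K` of `R`, with `A` the completion. -/
noncomputable def quotientMapEquiv (hI : I.FG) (K : Ideal R) (n : ℕ) (hK : I ^ n ≤ K) :
    (R ⧸ K) ≃+* (AdicCompletion I R ⧸ K.map (algebraMap R (AdicCompletion I R))) :=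
  RingEquiv.ofBijective
    (Ideal.quotientMap (K.map (algebraMap R (AdicCompletion I R))) (algebraMap R _)
      Ideal.le_comap_map)
    ⟨Ideal.quotientMap_injective' fun _ hr => (algebraMap_mem_map_iff hK).1 hr, fun x => by
      obtain ⟨x, rfl⟩ := Ideal.Quotient.mk_surjective x
      obtain ⟨r, hr⟩ := exists_sub_algebraMap_mem hI n x
      refine ⟨Ideal.Quotient.mk _ r, ?_⟩
      rw [Ideal.quotientMap_mk, eq_comm, Ideal.Quotient.eq]
      exact Ideal.map_mono hK hr⟩

theorem length_quotient_map (hI : I.FG) {K : Ideal R} {n : ℕ} (hK : I ^ n ≤ K) :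
    Module.length (AdicCompletion I R)
      (AdicCompletion I R ⧸ K.map (algebraMap R (AdicCompletion I R))) =
    Module.length R (R ⧸ K) := by
  let e := quotientMapEquiv I hI K n hK
  let A := AdicCompletion I R
  let el : (R ⧸ K) ≃ₗ[R] (A ⧸ K.map (algebraMap R A)) :=
    { e with map_smul' := fun r x => by
              obtain ⟨x, rfl⟩ := Ideal.Quotient.mk_surjective x
              change e (Ideal.Quotient.mk K (r * x)) = r • e (Ideal.Quotient.mk K x)
              rw [map_mul, map_mul, Algebra.smul_def]
              rfl }
  rw [el.length_eq]
  rw [Module.length_eq_of_surjective (S := A) (R := A ⧸ K.map (algebraMap R A))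
    Ideal.Quotient.mk_surjective]
  refine (Module.length_eq_of_surjective (S := R) (R := A ⧸ K.map (algebraMap R A)) ?_).symm
  intro x
  obtain ⟨y, rfl⟩ := e.surjective x
  obtain ⟨r, rfl⟩ := Ideal.Quotient.mk_surjective y
  exact ⟨r, rfl⟩

theorem isAdicComplete_span_algebraMap (m : R) :
    IsAdicComplete (Ideal.span {algebraMap R (AdicCompletion (Ideal.span {m}) R) m})
      (AdicCompletion (Ideal.span {m}) R) := by
  have := isAdicComplete_self (Ideal.span {m}) ⟨{m}, by simp⟩
  rwa [Ideal.map_span, Set.image_singleton] at this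

theorem algebraMap_mem_nonZeroDivisors {m : R} (hm : m ∈ nonZeroDivisors R) :
    algebraMap R (AdicCompletion (Ideal.span {m}) R) m ∈ nonZeroDivisors _ := by
  have hfg : (Ideal.span {m}).FG := ⟨{m}, by simp⟩
  rw [mem_nonZeroDivisors_iff_right]
  intro x hx
  apply ext_evalₐ
  intro n
  obtain ⟨r, hr⟩ := exists_sub_algebraMap_mem hfg n x
  have hxn : x ∈ (Ideal.span {m} ^ n).map
      (algebraMap R (AdicCompletion (Ideal.span {m}) R)) := by
    have h1 : algebraMap R (AdicCompletion (Ideal.span {m}) R) (r * m) ∈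
        (Ideal.span {m} ^ (n + 1)).map (algebraMap R (AdicCompletion (Ideal.span {m}) R)) := by
      have h2 := Ideal.mul_mem_mul hr
        (Ideal.mem_map_of_mem (algebraMap R (AdicCompletion (Ideal.span {m}) R))
          (Ideal.mem_span_singleton_self m))
      rw [← Ideal.map_mul, ← pow_succ, sub_mul, hx, zero_sub, neg_mem_iff, ← map_mul] at h2
      exact h2
    rw [algebraMap_mem_map_iff le_rfl, Ideal.span_singleton_pow, Ideal.mem_span_singleton,
      pow_succ] at h1
    obtain ⟨c, hc⟩ := h1
    have hrm : r = m ^ n * c := by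
      rw [← sub_eq_zero]
      refine mem_nonZeroDivisors_iff_right.1 hm _ ?_
      rw [sub_mul, hc]; ring
    have h3 : r ∈ Ideal.span {m} ^ n := by
      rw [Ideal.span_singleton_pow, Ideal.mem_span_singleton]; exact ⟨c, hrm⟩
    simpa using add_mem hr (Ideal.mem_map_of_mem (algebraMap R _) h3)
  rw [(mem_map_pow_iff_evalₐ hfg).1 hxn, _root_.map_zero]

section IsLocalRing

variable [IsLocalRing R] {m : R}

theorem isLocalRing_of_mem_maximalIdeal (hm : m ∈ maximalIdeal R) :
    IsLocalRing (AdicCompletion (Ideal.span {m}) R) := by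
  have hfg : (Ideal.span {m}).FG := ⟨{m}, by simp⟩
  have hmax := isMaximal_map_of_le (Ideal.span {m}) (maximalIdeal R)
    ((Ideal.span_singleton_le_iff_mem _).2 hm) hfg
  have := isAdicComplete_self (Ideal.span {m}) hfg
  have hjac := IsAdicComplete.le_jacobson_bot
    ((Ideal.span {m}).map (algebraMap R (AdicCompletion (Ideal.span {m}) R)))
  refine IsLocalRing.of_unique_max_ideal ⟨_, hmax, fun J hJ => ?_⟩
  have hmJ : (Ideal.span {m}).map (algebraMap R (AdicCompletion (Ideal.span {m}) R)) ≤ J :=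
    hjac.trans (sInf_le ⟨bot_le, hJ⟩)
  refine hJ.eq_of_le hmax.ne_top fun x hx => ?_
  obtain ⟨r, hr⟩ := exists_sub_algebraMap_mem hfg 1 x
  rw [pow_one] at hr
  have hrJ : algebraMap R (AdicCompletion (Ideal.span {m}) R) r ∈ J := by
    have := sub_mem hx (hmJ hr)
    rwa [sub_sub_cancel] at this
  have hrm : r ∈ maximalIdeal R := fun hu =>
    hJ.ne_top (J.eq_top_of_isUnit_mem hrJ (hu.map _))
  have := add_mem (Ideal.map_mono ((Ideal.span_singleton_le_iff_mem _).2 hm) hr)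
    (Ideal.mem_map_of_mem (algebraMap R (AdicCompletion (Ideal.span {m}) R)) hrm)
  rwa [sub_add_cancel] at this

theorem maximalIdeal_eq_map_of_mem (hm : m ∈ maximalIdeal R)
    [IsLocalRing (AdicCompletion (Ideal.span {m}) R)] :
    maximalIdeal (AdicCompletion (Ideal.span {m}) R) =
      (maximalIdeal R).map (algebraMap R (AdicCompletion (Ideal.span {m}) R)) :=
  (IsLocalRing.eq_maximalIdeal (isMaximal_map_of_le (Ideal.span {m}) (maximalIdeal R)
    ((Ideal.span_singleton_le_iff_mem _).2 hm) ⟨{m}, by simp⟩)).symm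

theorem length_quotient_maximalIdeal_pow (hm : m ∈ maximalIdeal R)
    [IsLocalRing (AdicCompletion (Ideal.span {m}) R)] (n : ℕ) :
    Module.length (AdicCompletion (Ideal.span {m}) R) (AdicCompletion (Ideal.span {m}) R ⧸
      maximalIdeal (AdicCompletion (Ideal.span {m}) R) ^ n) =
    Module.length R (R ⧸ maximalIdeal R ^ n) := by
  rw [maximalIdeal_eq_map_of_mem hm, ← Ideal.map_pow]
  exact length_quotient_map ⟨{m}, by simp⟩
    (Ideal.pow_right_mono ((Ideal.span_singleton_le_iff_mem _).2 hm) n)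

end IsLocalRing

/-- The ring isomorphism `R / m R ≃ A / m A`, with `A` the `m`-adic completion of `R`. -/
noncomputable def quotientSpanEquiv (m : R) : (R ⧸ Ideal.span {m}) ≃+*
    (AdicCompletion (Ideal.span {m}) R ⧸
      Ideal.span {algebraMap R (AdicCompletion (Ideal.span {m}) R) m}) :=
  (quotientMapEquiv (Ideal.span {m}) ⟨{m}, by simp⟩ (Ideal.span {m}) 1 (by simp)).trans
    (Ideal.quotEquivOfEq (by rw [Ideal.map_span, Set.image_singleton]))

theorem isNoetherianRing_of_quotient_span {m : R} [IsNoetherianRing (R ⧸ Ideal.span {m})] :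
    IsNoetherianRing (AdicCompletion (Ideal.span {m}) R) := by
  have := isAdicComplete_span_algebraMap m
  have := isNoetherianRing_of_ringEquiv _ (quotientSpanEquiv m)
  exact isNoetherianRing_of_isAdicComplete_span_singleton (algebraMap R _ m)

theorem ringKrullDim_eq_one [IsLocalRing R] {m : R} (hmM : m ∈ maximalIdeal R)
    (hm : m ∈ nonZeroDivisors R) (hdim : ringKrullDim R = 1)
    [IsLocalRing (AdicCompletion (Ideal.span {m}) R)]
    [IsNoetherianRing (AdicCompletion (Ideal.span {m}) R)] :
    ringKrullDim (AdicCompletion (Ideal.span {m}) R) = 1 := by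
  have hmA : algebraMap R (AdicCompletion (Ideal.span {m}) R) m ∈ maximalIdeal _ := by
    rw [maximalIdeal_eq_map_of_mem hmM]
    exact Ideal.mem_map_of_mem _ hmM
  rw [← ringKrullDim_quotient_span_singleton_succ_eq_ringKrullDim_of_mem_nonZeroDivisors
    (algebraMap_mem_nonZeroDivisors hm) hmA, ← ringKrullDim_eq_of_ringEquiv (quotientSpanEquiv m),
    ringKrullDim_quotient_span_singleton_eq_zero hdim hmM hm, zero_add]

end AdicCompletion

section RelLength

variable {R E : Type*} [CommRing R] [AddCommGroup E] [Module R E]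

theorem relLength_pow_smul_ne_top {N : Submodule R E} {y : R} (hy : IsSMulRegular E y)
    (h : relLength (y • N) N ≠ ⊤) (n : ℕ) : relLength (y ^ n • N) N ≠ ⊤ := by
  induction n with
  | zero => rw [pow_zero, one_smul, relLength_eq_zero.2 le_rfl]; exact ENat.zero_ne_top
  | succ n ih =>
    rw [pow_succ, mul_smul, relLength_eq_add
      (smul_mono_right (y ^ n) (Submodule.smul_le_self_of_tower y N))
      (Submodule.smul_le_self_of_tower (y ^ n) N), relLength_smul (hy.pow n)]
    exact WithTop.add_ne_top.2 ⟨h, ih⟩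

theorem relLength_anti_left {I J K : Submodule R E} (hIJ : I ≤ J) (hJK : J ≤ K) :
    relLength J K ≤ relLength I K := by
  rw [relLength_eq_add hIJ hJK]; exact le_add_self

theorem relLength_mono_right {I J K : Submodule R E} (hIJ : I ≤ J) (hJK : J ≤ K) :
    relLength I J ≤ relLength I K := by
  rw [relLength_eq_add hIJ hJK]; exact le_self_add

theorem relLength_smul_eq {N N' : Submodule R E} {y : R} (hy : IsSMulRegular E y) (hN : N ≤ N')
    (h : relLength N N' ≠ ⊤) : relLength (y • N) N = relLength (y • N') N' := by
  have h1 := relLength_eq_add (Submodule.smul_le_self_of_tower y N) hN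
  rw [relLength_eq_add (smul_mono_right y hN) (Submodule.smul_le_self_of_tower y N'),
    relLength_smul hy, add_comm] at h1
  exact (WithTop.add_right_cancel h h1).symm

theorem Submodule.FG.of_le_of_relLength_ne_top {K N : Submodule R E} (hK : K.FG) (hKN : K ≤ N)
    (h : relLength K ⊤ ≠ ⊤) : N.FG := by
  rw [relLength_top, Module.length_ne_top_iff, isFiniteLength_iff_isNoetherian_isArtinian] at h
  have := h.1
  refine Submodule.fg_of_fg_map_of_fg_inf_ker K.mkQ (IsNoetherian.noetherian _) ?_
  rwa [Submodule.ker_mkQ, inf_eq_right.2 hKN]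

theorem eq_of_relLength_le_two {K L L' N : Submodule R E} (h : relLength K N ≤ 2) (hKL : K < L)
    (hLL : L ≤ L') (hLN : L' < N) : L = L' := by
  by_contra hne
  have hpos {A B : Submodule R E} (hAB : A < B) : 1 ≤ relLength A B := by
    rw [Order.one_le_iff_ne_zero, Ne, relLength_eq_zero]
    exact hAB.not_ge
  have h3 : (1 : ℕ∞) + (1 + 1) ≤ 2 := by
    refine le_trans ?_ h
    rw [relLength_eq_add hKL.le (hLL.trans hLN.le), relLength_eq_add hLL hLN.le]
    gcongr
    · exact hpos hKL
    · exact hpos (lt_of_le_of_ne hLL hne)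
    · exact hpos hLN
  exact absurd h3 (by decide)

end RelLength

section Reduction

theorem isSMulRegular_of_mem_nonZeroDivisors {R : Type*} [CommRing R] {y : R}
    (hy : y ∈ nonZeroDivisors R) :
    IsSMulRegular R y :=
  (isRegular_iff_mem_nonZeroDivisors.2 hy).left

theorem smul_top_eq_span {R : Type*} [CommRing R] (y : R) : y • (⊤ : Ideal R) = Ideal.span {y} := by
  rw [← Submodule.ideal_span_singleton_smul]; simp

theorem Ideal.pow_add_two_le {R : Type*} [CommRing R] {I Q : Ideal R} {k : ℕ}
    (h : ∀ x ∈ I, ∀ z ∈ I, ∀ u ∈ I ^ k, x * (z * u) ∈ Q) : I ^ (k + 2) ≤ Q := by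
  rw [pow_succ', pow_succ', Ideal.mul_le]
  intro x hx s hs
  refine Submodule.mul_induction_on hs (fun z hz u hu => h x hx z hz u hu) fun s t hs ht => ?_
  rw [mul_add]
  exact add_mem hs ht

variable {R : Type*} [CommRing R] [IsLocalRing R]

/-- If a power `M ^ n`, `n ≥ 2`, of the maximal ideal of a local ring is two-generated, then
`M ^ n = y M ^ (n - 1)` for some `y ∈ M`. -/
theorem exists_maximalIdeal_pow_eq_smul {k : ℕ} (h : TwoGenerated (maximalIdeal R ^ (k + 2))) :
    ∃ y ∈ maximalIdeal R, maximalIdeal R ^ (k + 2) = y • maximalIdeal R ^ (k + 1) := by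
  obtain ⟨p, q, hpq⟩ := h
  set M := maximalIdeal R with hM
  set N := M ^ (k + 2) with hN
  have hNfg : N.FG := by rw [hpq]; exact Submodule.fg_span (by simp)
  let W : Ideal R := M • N
  let P (x : R) : Ideal R := x • M ^ (k + 1) ⊔ W
  have hsmul {x : R} (hx : x ∈ M) : x • M ^ (k + 1) ≤ N := by
    rintro _ ⟨u, hu, rfl⟩
    rw [hN, pow_succ' M (k + 1)]
    exact Ideal.mul_mem_mul hx hu
  suffices hP : ∃ y ∈ M, N ≤ P y by
    obtain ⟨y, hy, hyN⟩ := hP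
    exact ⟨y, hy, le_antisymm (Submodule.le_of_le_smul_of_le_jacobson_bot hNfg
      (maximalIdeal_le_jacobson _) hyN) (hsmul hy)⟩
  by_contra! hcon
  have hlen : relLength W N ≤ 2 := by
    have hW : W ≤ Ideal.span {p, q} := hpq ▸ Submodule.smul_le_right
    rw [hpq]
    refine relLength_span_pair_le (fun r hr => ?_) (fun r hr => ?_) hW
    all_goals
      refine Submodule.smul_mem_smul hr ?_
      rw [hpq]
      exact Ideal.subset_span (by simp)
  have hPN {x : R} (hx : x ∈ M) : P x < N :=
    lt_of_le_not_ge (sup_le (hsmul hx) Submodule.smul_le_right) (hcon x hx)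
  have hWN : ¬ N ≤ W := fun h => hcon 0 (zero_mem _) (h.trans le_sup_right)
  have hprod {Q : Ideal R} (hQ : ¬ N ≤ Q) :
      ∃ x ∈ M, ∃ z ∈ M, ∃ u ∈ M ^ k, x * (z * u) ∉ Q := by
    by_contra! hc
    exact hQ (Ideal.pow_add_two_le hc)
  have hmem {x z u : R} (hz : z ∈ M) (hu : u ∈ M ^ k) : x * (z * u) ∈ P x := by
    refine Submodule.mem_sup_left (Submodule.smul_mem_pointwise_smul _ x _ ?_)
    rw [pow_succ']
    exact Ideal.mul_mem_mul hz hu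
  have hline {a x : R} (hx : x ∈ M) (ha : a ∈ P x) (haW : a ∉ W) : R ∙ a ⊔ W = P x := by
    refine eq_of_relLength_le_two hlen (lt_of_le_not_ge le_sup_right fun h => haW (h ?_))
      (sup_le ((Submodule.span_singleton_le_iff_mem _ _).2 ha) le_sup_right) (hPN hx)
    exact Submodule.mem_sup_left (Submodule.mem_span_singleton_self a)
  obtain ⟨x₁, hx₁, x₂, hx₂, u, hu, ha⟩ := hprod hWN
  obtain ⟨z₁, hz₁, z₂, hz₂, v, hv, hb⟩ := hprod (hcon x₁ hx₁)
  set a := x₁ * (x₂ * u) with ha_def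
  set b := z₁ * (z₂ * v) with hb_def
  have hbW : b ∉ W := fun h => hb (Submodule.mem_sup_right h)
  have hx₁a := hline hx₁ (hmem hx₂ hu) ha
  have hx₂a := hline (a := a) hx₂ (by rw [ha_def, mul_left_comm]; exact hmem hx₁ hu) ha
  have hz₁b := hline hz₁ (hmem hz₂ hv) hbW
  have hz₂b := hline (a := b) hz₂ (by rw [hb_def, mul_left_comm]; exact hmem hz₁ hv) hbW
  have hinf : P x₁ ⊓ P z₁ ≤ W := by
    by_contra hc
    have hlt : W < P x₁ ⊓ P z₁ := lt_of_le_not_ge (le_inf le_sup_right le_sup_right) hc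
    have h1 := eq_of_relLength_le_two hlen hlt inf_le_left (hPN hx₁)
    have h2 := eq_of_relLength_le_two hlen hlt inf_le_right (hPN hz₁)
    exact hb (show b ∈ P x₁ from (h1.symm.trans h2) ▸ hmem hz₂ hv)
  have hxz : x₁ * (z₂ * v) ∈ W := hinf ⟨hmem hz₂ hv, by
    rw [← hz₁b, hz₂b, mul_left_comm]; exact hmem hx₁ hv⟩
  have hzx : z₁ * (x₂ * u) ∈ W := hinf ⟨by
    rw [← hx₁a, hx₂a, mul_left_comm]; exact hmem hz₁ hu, hmem hx₂ hu⟩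
  have hy : x₁ + z₁ ∈ M := add_mem hx₁ hz₁
  have hay : a ∈ P (x₁ + z₁) := by
    have h := sub_mem (hmem (x := x₁ + z₁) hx₂ hu) (Submodule.mem_sup_right hzx)
    rwa [add_mul, add_sub_cancel_right] at h
  have hby : b ∈ P (x₁ + z₁) := by
    have h := sub_mem (hmem (x := x₁ + z₁) hz₂ hv) (Submodule.mem_sup_right hxz)
    rwa [add_mul, add_sub_cancel_left] at h
  exact hb (show b ∈ P x₁ by rw [← hx₁a, hline hy hay ha]; exact hby)

/-- A two-generated power of the maximal ideal yields a parameter `y` of colength at most two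
with `M ^ (j + 1) = y M ^ j` for large `j`, where the `M ^ j` have finite colength. -/
theorem exists_parameter {m : R} (hmM : m ∈ maximalIdeal R) (hm : m ∈ nonZeroDivisors R) {k : ℕ}
    (h : TwoGenerated (maximalIdeal R ^ (k + 2))) :
    ∃ y ∈ maximalIdeal R, y ∈ nonZeroDivisors R ∧ relLength (y • (⊤ : Ideal R)) ⊤ ≤ 2 ∧
      (∀ j, k + 1 ≤ j → maximalIdeal R ^ (j + 1) = y • maximalIdeal R ^ j) ∧
      ∀ j, k + 2 ≤ j → relLength (maximalIdeal R ^ j) ⊤ ≠ ⊤ := by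
  obtain ⟨y, hyM, hy⟩ := exists_maximalIdeal_pow_eq_smul h
  have hyR : y ∈ nonZeroDivisors R := by
    have h1 : m ^ (k + 2) ∈ y • maximalIdeal R ^ (k + 1) := hy ▸ Ideal.pow_mem_pow hmM _
    obtain ⟨w, -, hw⟩ := (Submodule.mem_smul_pointwise_iff_exists _ _ _).1 h1
    have h2 : y * w ∈ nonZeroDivisors R := by
      rw [← smul_eq_mul, hw]; exact pow_mem hm _
    exact (mul_mem_nonZeroDivisors.1 h2).1
  have hys := isSMulRegular_of_mem_nonZeroDivisors hyR
  have hpow (j : ℕ) (hj : k + 1 ≤ j) : maximalIdeal R ^ (j + 1) = y • maximalIdeal R ^ j := by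
    induction j, hj using Nat.le_induction with
    | base => exact hy
    | succ j hj ih =>
      rw [pow_succ', ih, ← Submodule.ideal_span_singleton_smul,
        ← Submodule.ideal_span_singleton_smul, smul_eq_mul, smul_eq_mul, mul_left_comm,
        ← pow_succ', ih, ← Submodule.ideal_span_singleton_smul, smul_eq_mul]
  set J := maximalIdeal R ^ (k + 2) with hJ
  have hJ2 : relLength (y • J) J ≤ 2 := by
    obtain ⟨p, q, hpq⟩ := h
    have hyJ : y • J = maximalIdeal R • J := by
      rw [hJ, ← hpow (k + 2) (by omega), pow_succ', smul_eq_mul]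
    rw [hyJ]
    have hle : maximalIdeal R • J ≤ Ideal.span {p, q} := hpq ▸ Submodule.smul_le_right
    nth_rw 2 [hpq]
    refine relLength_span_pair_le (fun r hr => ?_) (fun r hr => ?_) hle
    all_goals
      refine Submodule.smul_mem_smul hr ?_
      rw [hpq]
      exact Ideal.subset_span (by simp)
  have htop : y ^ (k + 2) • (⊤ : Ideal R) ≤ J := by
    rw [smul_top_eq_span, Ideal.span_singleton_le_iff_mem]
    exact Ideal.pow_mem_pow hyM _
  have hJtop : relLength J ⊤ ≠ ⊤ := by
    have h1 := relLength_pow_smul_ne_top hys (ne_top_of_le_ne_top (by decide) hJ2) (k + 2)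
    rw [← relLength_smul (hys.pow (k + 2))]
    exact ne_top_of_le_ne_top h1 (relLength_mono_right (smul_mono_right _ le_top) htop)
  refine ⟨y, hyM, hyR, ?_, hpow, fun j hj => ?_⟩
  · rwa [← relLength_smul_eq hys le_top hJtop]
  · induction j, hj using Nat.le_induction with
    | base => exact hJtop
    | succ j hj ih =>
      rw [relLength_eq_add (Ideal.pow_le_pow_right j.le_succ) le_top, hpow j (by omega),
        relLength_smul_eq hys le_top ih, ← relLength_smul_eq hys le_top hJtop]
      exact WithTop.add_ne_top.2 ⟨ne_top_of_le_ne_top (by decide) hJ2, ih⟩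

theorem relLength_smul_top_ne_top (hdim : ringKrullDim R = 1) {x y : R}
    (hxM : x ∈ maximalIdeal R) (hx : x ∈ nonZeroDivisors R) (hyM : y ∈ maximalIdeal R)
    (hy : y ∈ nonZeroDivisors R) (h : relLength (y • (⊤ : Ideal R)) ⊤ ≠ ⊤) :
    relLength (x • (⊤ : Ideal R)) ⊤ ≠ ⊤ := by
  have hxt : Ideal.span {x} ≠ ⊤ := fun hc =>
    (mem_maximalIdeal x).1 hxM (Ideal.span_singleton_eq_top.1 hc)
  have : Nontrivial (R ⧸ Ideal.span {x}) := Ideal.Quotient.nontrivial_iff.2 hxt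
  have : IsLocalRing (R ⧸ Ideal.span {x}) :=
    IsLocalRing.of_surjective' (Ideal.Quotient.mk _) Ideal.Quotient.mk_surjective
  have : Ring.KrullDimLE 0 (R ⧸ Ideal.span {x}) := ringKrullDimZero_iff_ringKrullDim_eq_zero.2
    (ringKrullDim_quotient_span_singleton_eq_zero hdim hxM hx)
  have hnil : IsNilpotent (Ideal.Quotient.mk (Ideal.span {x}) y) := by
    rw [Ring.KrullDimLE.isNilpotent_iff_mem_maximalIdeal, mem_maximalIdeal, mem_nonunits_iff]
    intro hu
    obtain ⟨z, hz⟩ := Ideal.Quotient.mk_surjective (↑hu.unit⁻¹ : R ⧸ Ideal.span {x})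
    have h1 : Ideal.Quotient.mk (Ideal.span {x}) (y * z) = Ideal.Quotient.mk _ 1 := by
      rw [map_mul, hz, map_one]; exact hu.mul_val_inv
    rw [Ideal.Quotient.eq] at h1
    have h2 : y * z - 1 ∈ maximalIdeal R := (Ideal.span_singleton_le_iff_mem _).2 hxM h1
    have h3 := sub_mem (Ideal.mul_mem_right z _ hyM) h2
    rw [sub_sub_cancel] at h3
    exact (Ideal.ne_top_iff_one _).1 (maximalIdeal.isMaximal R).ne_top h3
  obtain ⟨n, hn⟩ := hnil
  rw [← map_pow, Ideal.Quotient.eq_zero_iff_mem] at hn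
  refine ne_top_of_le_ne_top
    (relLength_pow_smul_ne_top (isSMulRegular_of_mem_nonZeroDivisors hy) h n)
    (relLength_anti_left ?_ le_top)
  rw [smul_top_eq_span, smul_top_eq_span]
  exact (Ideal.span_singleton_le_iff_mem _).2 hn

theorem twoGenerated_of_parameter (hdim : ringKrullDim R = 1) {y : R} (hyM : y ∈ maximalIdeal R)
    (hy : y ∈ nonZeroDivisors R) (h : relLength (y • (⊤ : Ideal R)) ⊤ ≤ 2) {I : Ideal R}
    (hI : RegularIdeal I) : TwoGenerated I := by
  obtain ⟨x, hxI, hx⟩ := hI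
  by_cases hxu : IsUnit x
  · exact ⟨1, 1, by simp [I.eq_top_of_isUnit_mem hxI hxu]⟩
  have htop := relLength_smul_top_ne_top hdim hxu hx hyM hy (ne_top_of_le_ne_top (by decide) h)
  rw [smul_top_eq_span] at htop
  have hxI' := (Ideal.span_singleton_le_iff_mem _).2 hxI
  have hItop := ne_top_of_le_ne_top htop (relLength_anti_left hxI' le_top)
  have hle : y • I ≤ maximalIdeal R • I := by
    rw [← Submodule.ideal_span_singleton_smul]
    exact Submodule.smul_mono_left ((Ideal.span_singleton_le_iff_mem _).2 hyM)
  refine exists_eq_span_pair (Submodule.FG.of_le_of_relLength_ne_top ⟨{x}, by simp⟩ hxI' htop)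
    ((relLength_anti_left hle Submodule.smul_le_right).trans ?_)
  rwa [relLength_smul_eq (isSMulRegular_of_mem_nonZeroDivisors hy) le_top hItop]

theorem exists_hilbert_of_parameter {y : R} (hyM : y ∈ maximalIdeal R)
    (hy : y ∈ nonZeroDivisors R) (h : relLength (y • (⊤ : Ideal R)) ⊤ ≤ 2) {n : ℕ}
    (hpow : ∀ j, n ≤ j → maximalIdeal R ^ (j + 1) = y • maximalIdeal R ^ j)
    (htop : ∀ j, n ≤ j → relLength (maximalIdeal R ^ j) ⊤ ≠ ⊤) :
    ∃ e : ℕ, e ≠ 0 ∧ e ≤ 2 ∧ ∃ c : ℚ, ∀ j, n ≤ j → ∃ l : ℕ,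
      Module.length R (R ⧸ maximalIdeal R ^ j) = l ∧ (l : ℚ) = e * j + c := by
  obtain ⟨e, he⟩ := ENat.ne_top_iff_exists.1 (ne_top_of_le_ne_top (by decide) h)
  have he2 : e ≤ 2 := by rw [← he] at h; exact_mod_cast h
  have he0 : e ≠ 0 := by
    rintro rfl
    rw [Nat.cast_zero, eq_comm, relLength_eq_zero, smul_top_eq_span, top_le_iff,
      Ideal.span_singleton_eq_top] at he
    exact hyM he
  obtain ⟨l, hl⟩ := ENat.ne_top_iff_exists.1 (htop n le_rfl)
  refine ⟨e, he0, he2, l - e * n, fun j hj => ?_⟩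
  induction j, hj using Nat.le_induction with
  | base => exact ⟨l, by rw [hl, relLength_top], by ring⟩
  | succ j hj ih =>
    obtain ⟨l', hl', hc⟩ := ih
    refine ⟨e + l', ?_, by push_cast; rw [hc]; ring⟩
    rw [← relLength_top, relLength_eq_add (Ideal.pow_le_pow_right j.le_succ) le_top, hpow j hj,
      relLength_smul_eq (isSMulRegular_of_mem_nonZeroDivisors hy) le_top (htop j hj), ← he,
      relLength_top, hl', Nat.cast_add]

end Reduction

section Multiplicity

theorem natDegree_one_eval_succ_sub {p : Polynomial ℚ} (hp : p.natDegree = 1) (x : ℚ) :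
    p.eval (x + 1) - p.eval x = p.leadingCoeff := by
  rw [Polynomial.eval_eq_sum_range, Polynomial.eval_eq_sum_range, hp, Polynomial.leadingCoeff, hp]
  simp [Finset.sum_range_succ]
  ring

theorem hasMultiplicity_of_linear {A : Type*} [CommRing A] [IsLocalRing A]
    (hdim : ringKrullDim A = 1) {e n : ℕ} (he : e ≠ 0) {c : ℚ}
    (h : ∀ j, n ≤ j → ∃ l : ℕ,
      Module.length A (A ⧸ maximalIdeal A ^ j) = l ∧ (l : ℚ) = e * j + c) :
    HasMultiplicity A e := by
  have he' : (e : ℚ) ≠ 0 := Nat.cast_ne_zero.2 he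
  refine ⟨1, Polynomial.C (e : ℚ) * Polynomial.X + Polynomial.C c, by simpa using hdim,
    Polynomial.natDegree_linear he', ?_, by
    rw [Polynomial.leadingCoeff_linear he', Nat.factorial_one, Nat.cast_one, one_mul]⟩
  filter_upwards [Filter.eventually_ge_atTop n] with j hj
  obtain ⟨l, h1, h2⟩ := h j hj
  exact ⟨l, h1, by simpa using h2⟩

variable {R : Type*} [CommRing R] [IsLocalRing R]

theorem exists_twoGenerated_pow_of_hilbert (hfg : (maximalIdeal R).FG) {p : Polynomial ℚ}
    (hp : p.natDegree = 1) (hp2 : p.leadingCoeff ≤ 2)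
    (h : ∀ᶠ n : ℕ in Filter.atTop, ∃ l : ℕ,
      Module.length R (R ⧸ maximalIdeal R ^ n) = l ∧ (l : ℚ) = p.eval (n : ℚ)) :
    ∃ n : ℕ, 2 ≤ n ∧ TwoGenerated (maximalIdeal R ^ n) := by
  obtain ⟨N, hN⟩ := Filter.eventually_atTop.1 h
  obtain ⟨l, hl, hlp⟩ := hN (N + 2) (by omega)
  obtain ⟨l', hl', hlp'⟩ := hN (N + 2 + 1) (by omega)
  refine ⟨N + 2, by omega, exists_eq_span_pair (Submodule.FG.pow hfg _) ?_⟩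
  have hle : maximalIdeal R ^ (N + 2 + 1) ≤ maximalIdeal R ^ (N + 2) :=
    Ideal.pow_le_pow_right (Nat.le_succ _)
  have hadd := relLength_eq_add hle le_top
  rw [relLength_top, relLength_top, hl, hl'] at hadd
  rw [smul_eq_mul, ← pow_succ']
  have hne : relLength (maximalIdeal R ^ (N + 2 + 1)) (maximalIdeal R ^ (N + 2)) ≠ ⊤ := by
    intro hc
    rw [hc, top_add] at hadd
    exact ENat.natCast_ne_top _ hadd
  obtain ⟨r, hr⟩ := ENat.ne_top_iff_exists.1 hne
  rw [← hr] at hadd ⊢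
  have hadd' : l' = r + l := by exact_mod_cast hadd
  have hsub := natDegree_one_eval_succ_sub hp ((N + 2 : ℕ) : ℚ)
  have h1 : p.eval (((N + 2 : ℕ) : ℚ) + 1) = l' := by rw [hlp']; push_cast; rfl
  rw [h1, ← hlp, hadd'] at hsub
  push_cast at hsub
  have hr2 : (r : ℚ) ≤ 2 := by linarith
  exact_mod_cast hr2

end Multiplicity

theorem theorem5p4 {R : Type*} [CommRing R] [IsLocalRing R]
    (hdim : ringKrullDim R = 1)
    (m : R) (hmM : m ∈ IsLocalRing.maximalIdeal R) (hm : m ∈ nonZeroDivisors R) :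
    List.TFAE [
      ∃ n : ℕ, 2 ≤ n ∧ TwoGenerated (IsLocalRing.maximalIdeal R ^ n),
      ∃ _ : IsLocalRing (AdicCompletion (Ideal.span {m}) R),
        IsNoetherianRing (AdicCompletion (Ideal.span {m}) R) ∧
        ∃ e : ℚ, HasMultiplicity (AdicCompletion (Ideal.span {m}) R) e ∧ e ≤ 2,
      ∀ I : Ideal R, RegularIdeal I → TwoGenerated I] := by
  tfae_have 1 → 3 := by
    rintro ⟨n, hn, h⟩ I hI
    obtain ⟨k, rfl⟩ := Nat.exists_eq_add_of_le' hn
    obtain ⟨y, hyM, hy, hy2, -, -⟩ := exists_parameter hmM hm h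
    exact twoGenerated_of_parameter hdim hyM hy hy2 hI
  tfae_have 3 → 1 := fun h => ⟨2, le_rfl, h _ ⟨m ^ 2, Ideal.pow_mem_pow hmM 2, pow_mem hm 2⟩⟩
  tfae_have 1 → 2 := by
    rintro ⟨n, hn, h⟩
    obtain ⟨k, rfl⟩ := Nat.exists_eq_add_of_le' hn
    obtain ⟨y, hyM, hy, hy2, hpow, htop⟩ := exists_parameter hmM hm h
    have hlocal := AdicCompletion.isLocalRing_of_mem_maximalIdeal hmM
    have hfin := relLength_smul_top_ne_top hdim hmM hm hyM hy
      (ne_top_of_le_ne_top (by decide) hy2)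
    rw [smul_top_eq_span, relLength_top, Module.length_ne_top_iff,
      isFiniteLength_iff_isNoetherian_isArtinian] at hfin
    have := hfin.1
    have : IsNoetherianRing (R ⧸ Ideal.span {m}) := isNoetherian_of_tower R inferInstance
    have hnoeth := AdicCompletion.isNoetherianRing_of_quotient_span (m := m)
    obtain ⟨e, he0, he2, c, hc⟩ := exists_hilbert_of_parameter hyM hy hy2
      (fun j hj => hpow j ((Nat.le_succ _).trans hj)) htop
    refine ⟨hlocal, hnoeth, e, hasMultiplicity_of_linear (n := k + 2) (c := c)
      (AdicCompletion.ringKrullDim_eq_one hmM hm hdim) he0 fun j hj => ?_, by exact_mod_cast he2⟩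
    rw [AdicCompletion.length_quotient_maximalIdeal_pow hmM]
    exact hc j hj
  tfae_have 2 → 1 := by
    rintro ⟨hlocal, hnoeth, e, ⟨d, p, hd, hpd, hlen, rfl⟩, he⟩
    rw [AdicCompletion.ringKrullDim_eq_one hmM hm hdim] at hd
    obtain rfl : d = 1 := by exact_mod_cast hd.symm
    have : IsNoetherianRing (R ⧸ Ideal.span {m}) :=
      isNoetherianRing_of_ringEquiv _ (AdicCompletion.quotientSpanEquiv m).symm
    have hfg : (maximalIdeal R).FG := by
      refine Ideal.fg_of_fg_map_of_fg_inf_ker_of_surjective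
        (f := Ideal.Quotient.mk (Ideal.span {m})) (IsNoetherian.noetherian _) ?_
        Ideal.Quotient.mk_surjective
      rw [Ideal.mk_ker, inf_eq_right.2 ((Ideal.span_singleton_le_iff_mem _).2 hmM)]
      exact ⟨{m}, by simp⟩
    refine exists_twoGenerated_pow_of_hilbert hfg hpd (by simpa using he) ?_
    filter_upwards [hlen] with n hn
    rwa [AdicCompletion.length_quotient_maximalIdeal_pow hmM] at hn
  tfae_finish
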